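/- Throughout, rings are commutative. Let $R$ be an integral domain. Elements $a,b\in R$ form an *idempotent pair* if $(a\ b)$ or $(b\ a)$ is the first row of an idempotent $2\times 2$ matrix over $R$ (equivalently, $a(1-a)\in bR$ or $b(1-b)\in aR$); $R$ is a *PRINC domain* if every ideal generated by an idempotent pair is principal. $R$ is *seminormal* if whenever $a,b\in R$ satisfy $a^2=b^3$, there is $c\in R$ with $c^3=a$ and $c^2=b$. Elements $c,d\in R$ are *comaximal* if $cR+dR=R$. A nonzero nonunit is *pseudo-irreducible* if it is not a product of two comaximal nonunits, and $R$ is a *comaximal factorization domain* (CFD) if every nonzero nonunit of $R$ is a product of finitely many pairwise comaximal pseudo-irreducible elements. A commutative monoid $S$ (written additively) is *pure* if it is isomorphic to a submonoid of $(\mathbb{Q}_{\ge 0},+)$, it is locally cyclic (for all $s_1,s_2\in S$ there is $s\in S$ with $\mathbb{N}s_1+\mathbb{N}s_2\subseteq \mathbb{N}s$), and for each $s\in S$ there is an integer $n>1$ with $s/n\in S$, i.e. $s=nt$ for some $t\in S$. For a prime $p$, a pure monoid $S$ is *$p$-divisible* if $s/p\in S$ for all $s\in S$, and *$p$-pure*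 if for each $s\in S$ there is an integer $n>1$ that is not a power of $p$ and satisfies $s/n\in S$. **Theorem.** Let $D$ be a seminormal PRINC domain of characteristic $\chi$ and let $S\neq\{0\}$ be a pure monoid such that: 1. if $\chi=0$ and $S$ is $p$-divisible for some prime $p$, then $D\supseteq\mathbb{Z}[1/p]$ for at least one prime $p$ for which $S$ is $p$-divisible; 2. if $\chi=0$ and $S$ is not $p$-divisible for any prime $p$, then $D\supseteq\mathbb{Q}$; 3. if $\chi\neq 0$, then $S$ is $\chi$-pure. Then the monoid domain $D[X;S]$ is a seminormal PRINC domain that is not a comaximal factorization domain. Moreover, for every nonzero $s\in S$ and every integer $m\ge 1$, the element $1-X^s$ is a product of $m$ pairwise comaximal nonunits of $D[X;S]$. -/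

import Mathlib

namespace ComaximalFact

section Rings

variable {R : Type*} [CommRing R]

/-- `(a b)` is the first row of an idempotent `2 × 2` matrix over `R`. -/
def IsIdempotentRow (a b : R) : Prop :=
  ∃ M : Matrix (Fin 2) (Fin 2) R, IsIdempotentElem M ∧ M 0 0 = a ∧ M 0 1 = b

/-- `a, b` form an idempotent pair: `(a b)` or `(b a)` is the first row of an idempotent
`2 × 2` matrix. -/
def IsIdempotentPair (a b : R) : Prop :=
  IsIdempotentRow a b ∨ IsIdempotentRow b a

theorem isIdempotentRow_iff (a b : R) : IsIdempotentRow a b ↔ b ∣ a * (1 - a) := by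
  constructor
  · rintro ⟨M, hM, rfl, rfl⟩
    have h := congrFun (congrFun hM 0) 0
    rw [Matrix.mul_apply, Fin.sum_univ_two] at h
    exact ⟨M 1 0, by linear_combination -h⟩
  · rintro ⟨c, hc⟩
    refine ⟨!![a, b; c, 1 - a], ?_, rfl, rfl⟩
    unfold IsIdempotentElem
    ext i j
    fin_cases i <;> fin_cases j <;> simp [Matrix.mul_apply, Fin.sum_univ_two]
    · linear_combination -hc
    · ring
    · ring
    · linear_combination -hc

/-- The usual divisibility form of an idempotent pair. -/
theorem isIdempotentPair_iff (a b : R) :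
    IsIdempotentPair a b ↔ b ∣ a * (1 - a) ∨ a ∣ b * (1 - b) := by
  unfold IsIdempotentPair
  rw [isIdempotentRow_iff, isIdempotentRow_iff]

/-- A nonzero nonunit which is not a product of two comaximal nonunits. -/
def IsPseudoIrreducible (b : R) : Prop :=
  b ≠ 0 ∧ ¬ IsUnit b ∧
    ∀ c d : R, IsCoprime c d → ¬ IsUnit c → ¬ IsUnit d → b ≠ c * d

/-- `b = c₁ ⋯ cₘ` with pairwise comaximal nonunits `cᵢ`. -/
def IsComaximalFactorization (b : R) {m : ℕ} (c : Fin m → R) : Prop :=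
  b = ∏ i, c i ∧ (∀ i, ¬ IsUnit (c i)) ∧ ∀ i j, i ≠ j → IsCoprime (c i) (c j)

/-- `b = c₁ ⋯ cₘ` with pairwise comaximal pseudo-irreducible `cᵢ`. -/
def IsCompleteComaximalFactorization (b : R) {m : ℕ} (c : Fin m → R) : Prop :=
  b = ∏ i, c i ∧ (∀ i, IsPseudoIrreducible (c i)) ∧ ∀ i j, i ≠ j → IsCoprime (c i) (c j)

variable (R)

/-- The PRINC property: every ideal generated by an idempotent pair is principal.
A PRINC domain is an integral domain with this property. -/
def IsPRINC : Prop :=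
  ∀ a b : R, IsIdempotentPair a b → (Ideal.span {a, b}).IsPrincipal

/-- Seminormality (of an integral domain), in Swan's form. -/
def IsSeminormal : Prop :=
  ∀ a b : R, a ^ 2 = b ^ 3 → ∃ c : R, c ^ 3 = a ∧ c ^ 2 = b

/-- Every nonzero nonunit has a complete comaximal factorization.
A comaximal factorization domain is an integral domain with this property. -/
def HasComaximalFactorizations : Prop :=
  ∀ b : R, b ≠ 0 → ¬ IsUnit b →
    ∃ (m : ℕ) (c : Fin m → R), IsCompleteComaximalFactorization b c

end Rings

section Monoids

variable (S : Type*) [AddCommMonoid S]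

/-- Any two cyclic submonoids lie in a common cyclic submonoid. -/
def IsLocallyCyclic : Prop :=
  ∀ s₁ s₂ : S, ∃ s : S,
    AddSubmonoid.multiples s₁ ⊔ AddSubmonoid.multiples s₂ ≤ AddSubmonoid.multiples s

/-- A pure monoid. No order has to be recorded on `S`: for a locally cyclic submonoid of the
nonnegative rationals the order is the divisibility order, so it is determined by the addition. -/
structure IsPureMonoid : Prop where
  embeds : ∃ T : AddSubmonoid NNRat, Nonempty (S ≃+ T)
  locallyCyclic : IsLocallyCyclic S
  divisible : ∀ s : S, ∃ n : ℕ, 1 < n ∧ ∃ t : S, n • t = s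

/-- `S` is `p`-divisible: every `s / p` lies in `S`. -/
def IsPDivisible (p : ℕ) : Prop := ∀ s : S, ∃ t : S, p • t = s

/-- The `p`-purity condition (on a pure monoid): for each `s` there is `n > 1`, not a power
of `p`, with `s / n` in `S`. -/
def IsPPure (p : ℕ) : Prop :=
  ∀ s : S, ∃ n : ℕ, 1 < n ∧ (∀ k : ℕ, n ≠ p ^ k) ∧ ∃ t : S, n • t = s

end Monoids

end ComaximalFact

open Polynomial

namespace ComaximalFact

universe u

/-! By local cyclicity, any finite set of elements of `D[X;S]` lies in a subring `D[X^s] ≅ D[X]`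
with `s ≠ 0`. Being a domain, seminormality and PRINC concern finitely many elements at a time, so
they pass from `D[X]` to `D[X;S]`.

For `D[X]`, the required polynomials (a common square and cube root, or a column and a row whose
product is a given idempotent matrix) exist over the fraction field `K`, since `K[X]` is a principal
ideal domain. Their coefficients are integral over `D`, and
`IsSeminormal.mem_lifts_of_forall_reduced` brings them down to `D`. It suffices that their images
over a reduced ring `B`, in which `D` acts through a field `k`, come from `k[X]`. They do: such
polynomials exist over `k` too, and over a reduced ring they are unique once suitably normalized.

The conditions on the characteristic give, for each `s`, some `n > 1` invertible in `D` with `s = n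
• t`. With `Y = X^t`, the factors of `1 - Y^n = (1 - Y)(1 + Y + ⋯ + Y^(n-1))` are comaximal because
the second is `n` modulo `1 - Y`. Repeating this on `1 - X^t` gives every length. By
`IsCompleteComaximalFactorization.le`, a complete comaximal factorization in a PRINC domain would
bound these lengths. -/

/-! ### Conductors and descent to a seminormal domain -/

theorem IsSeminormal.mem_range_of_sq_of_cube {D K : Type*} [CommRing D] [Field K]
    [Algebra D K] [FaithfulSMul D K] (hD : IsSeminormal D) {x : K}
    (h2 : x ^ 2 ∈ (algebraMap D K).range) (h3 : x ^ 3 ∈ (algebraMap D K).range) :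
    x ∈ (algebraMap D K).range := by
  obtain ⟨b, hb⟩ := h2
  obtain ⟨a, ha⟩ := h3
  obtain ⟨c, rfl, rfl⟩ := hD a b (FaithfulSMul.algebraMap_injective D K (by
    rw [map_pow, map_pow, ha, hb]; ring))
  rw [map_pow] at ha hb
  refine ⟨c, ?_⟩
  by_cases hx : x = 0
  · subst hx
    exact pow_eq_zero_iff (two_ne_zero) |>.1 (by simpa using hb)
  · refine mul_right_cancel₀ (pow_ne_zero 2 hx) ?_
    linear_combination ha - algebraMap D K c * hb

/-- The conductor of a subalgebra `T` of `K` in the base ring, as an ideal of `T`. -/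
def conductorIdeal {D K : Type*} [CommRing D] [Field K] [Algebra D K] (T : Subalgebra D K) :
    Ideal T where
  carrier := {t | ∀ s : T, ((t * s : T) : K) ∈ (algebraMap D K).range}
  add_mem' {a b} ha hb s := by
    rw [add_mul]
    exact add_mem (ha s) (hb s)
  zero_mem' s := by simp
  smul_mem' c x hx s := by
    have := hx (c * s)
    rwa [smul_eq_mul, mul_assoc, mul_left_comm]

/-- If `t ^ 2` is in the conductor, then `(t s)^2 = t^2 s^2` and `(t s)^3 = t^2 (t s^3)` both lie in
`D`, hence so does `t s`. -/
theorem IsSeminormal.isRadical_conductorIdeal {D K : Type*} [CommRing D] [Field K]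
    [Algebra D K] [FaithfulSMul D K] (hD : IsSeminormal D) (T : Subalgebra D K) :
    (conductorIdeal T).IsRadical := by
  refine (Ideal.isRadical_iff_pow_one_lt (I := conductorIdeal T) 2 (by norm_num)).2 ?_
  intro t ht s
  refine hD.mem_range_of_sq_of_cube ?_ ?_
  · convert! ht (s ^ 2) using 1
    push_cast; ring
  · convert! ht (t * s ^ 3) using 1
    push_cast; ring

/-- Otherwise some prime over `I` avoids both `x` and the complement of `P`, so it is strictly
smaller than `P`. -/
theorem exists_notMem_mul_pow_mem_of_mem_minimalPrimes {R : Type*} [CommRing R] {I P : Ideal R}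
    (hP : P ∈ I.minimalPrimes) {x : R} (hx : x ∈ P) :
    ∃ s, s ∉ P ∧ ∃ n : ℕ, s * x ^ n ∈ I := by
  by_contra! H
  have hPp : P.IsPrime := hP.1.1
  let M : Submonoid R := P.primeCompl ⊔ Submonoid.powers x
  have hdisj : Disjoint (I : Set R) (M : Set R) := by
    rw [Set.disjoint_left]
    intro y hyI hyM
    obtain ⟨s, hs, z, ⟨n, rfl⟩, rfl⟩ := Submonoid.mem_sup.1 hyM
    exact H s hs n hyI
  obtain ⟨Q, hQ, hIQ, hQM⟩ := Ideal.exists_le_prime_disjoint I M hdisj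
  have hQP : Q ≤ P := fun y hy => by
    by_contra hyP
    exact Set.disjoint_left.1 hQM hy (Submonoid.mem_sup_left hyP)
  exact Set.disjoint_left.1 hQM (hP.2 ⟨hQ, hIQ⟩ hQP hx)
    (Submonoid.mem_sup_right (Submonoid.mem_powers x))

/-- The localization of `T / c` at a minimal prime `P` of `c ∩ D` is a reduced ring, and the image
of `D` in it generates a field. -/
theorem exists_reduced_of_mem_minimalPrimes {D T : Type u} [CommRing D] [CommRing T] [Algebra D T]
    {c : Ideal T} (hc : c.IsRadical) {P : Ideal D}
    (hP : P ∈ (c.comap (algebraMap D T)).minimalPrimes) :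
    ∃ (k B : Type u) (_ : Field k) (_ : CommRing B) (_ : IsReduced B) (α : D →+* k) (ψ : k →+* B)
      (φ : T →+* B), φ.comp (algebraMap D T) = ψ.comp α ∧
      (∀ z : k, ∃ d s, s ∉ P ∧ φ (algebraMap D T s) * ψ z = φ (algebraMap D T d)) ∧
      ∀ t, φ t = 0 → ∃ s, s ∉ P ∧ algebraMap D T s * t ∈ c := by
  have hPp : P.IsPrime := hP.1.1
  have : IsReduced (T ⧸ c) := (Ideal.isRadical_iff_quotient_reduced c).1 hc
  let M : Submonoid (T ⧸ c) := P.primeCompl.map (algebraMap D (T ⧸ c))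
  let φ : T →+* Localization M := (algebraMap (T ⧸ c) (Localization M)).comp (Ideal.Quotient.mk c)
  have hφ (t : T) : φ t = 0 ↔ ∃ s, s ∉ P ∧ algebraMap D T s * t ∈ c := by
    change algebraMap (T ⧸ c) (Localization M) (Ideal.Quotient.mk c t) = 0 ↔ _
    rw [IsLocalization.map_eq_zero_iff M]
    constructor
    · rintro ⟨⟨_, s, hs, rfl⟩, h0⟩
      exact ⟨s, hs, by rw [← Ideal.Quotient.eq_zero_iff_mem, map_mul]; exact h0⟩
    · rintro ⟨s, hs, h0⟩
      refine ⟨⟨_, s, hs, rfl⟩, ?_⟩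
      rw [← Ideal.Quotient.eq_zero_iff_mem, map_mul] at h0
      exact h0
  -- Minimality makes the image of each element of `P` nilpotent, hence zero in the reduced
  -- localization; so the residue field of `P` maps to it.
  have h1 : P ≤ RingHom.ker (φ.comp (algebraMap D T)) := by
    intro x hx
    obtain ⟨s, hs, n, hn⟩ := exists_notMem_mul_pow_mem_of_mem_minimalPrimes hP hx
    rw [RingHom.mem_ker]
    refine IsReduced.eq_zero _ ⟨n, ?_⟩
    rw [RingHom.comp_apply, ← map_pow, hφ]
    refine ⟨s, hs, ?_⟩
    rw [← map_pow, ← map_mul]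
    exact hn
  have h2 : P.primeCompl ≤ (IsUnit.submonoid (Localization M)).comap
      (φ.comp (algebraMap D T)) := by
    intro s hs
    exact IsLocalization.map_units (Localization M) (⟨_, s, hs, rfl⟩ : M)
  have e (r : D) : Ideal.ResidueField.lift P _ h1 h2 (algebraMap D _ r) = φ (algebraMap D T r) :=
    Ideal.ResidueField.lift_algebraMap _ _ h1 h2 r
  refine ⟨P.ResidueField, Localization M, inferInstance, inferInstance, inferInstance,
    algebraMap D _, Ideal.ResidueField.lift P _ h1 h2, φ, ?_, ?_, fun t => (hφ t).1⟩
  · ext x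
    exact (e x).symm
  · intro z
    obtain ⟨d, s, hs, rfl⟩ := IsFractionRing.div_surjective (A := D ⧸ P) z
    obtain ⟨d, rfl⟩ := Ideal.Quotient.mk_surjective d
    obtain ⟨s, rfl⟩ := Ideal.Quotient.mk_surjective s
    have hsP : s ∉ P := by
      intro hsP
      rw [Ideal.Quotient.eq_zero_iff_mem.2 hsP] at hs
      exact zero_notMem_nonZeroDivisors hs
    have hs0 : algebraMap D P.ResidueField s ≠ 0 := by
      rwa [Ne, Ideal.algebraMap_residueField_eq_zero]
    refine ⟨d, s, hsP, ?_⟩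
    rw [Ideal.algebraMap_quotient_residueField_mk, Ideal.algebraMap_quotient_residueField_mk,
      ← e, ← e, ← map_mul, mul_div_cancel₀ _ hs0]

/-- If `T = D[E]` is generated by finitely many integral elements of `K` and `D` is seminormal,
then `E ⊆ D` as soon as, in every reduced `T`-algebra `B` in which the image of `D` lies in a
field `k`, the image of `E` lies in `k`. -/
theorem IsSeminormal.subset_range_of_forall_reduced {D K : Type u} [CommRing D] [Field K]
    [Algebra D K] [FaithfulSMul D K] (hD : IsSeminormal D) {E : Set K} (hE : E.Finite)
    (hint : ∀ e ∈ E, IsIntegral D e)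
    (h : ∀ (k B : Type u) [Field k] [CommRing B] [IsReduced B] (α : D →+* k) (ψ : k →+* B)
      (φ : Algebra.adjoin D E →+* B), φ.comp (algebraMap D _) = ψ.comp α →
      ∀ e (he : e ∈ E), φ ⟨e, Algebra.subset_adjoin he⟩ ∈ ψ.range) :
    E ⊆ (algebraMap D K).range := by
  classical
  set T := Algebra.adjoin D E
  let c := conductorIdeal T
  by_cases htop : c.comap (algebraMap D T) = ⊤
  · intro e he
    have h1 : (1 : D) ∈ c.comap (algebraMap D T) := htop ▸ Submodule.mem_top
    have h2 : (1 : T) ∈ c := by simpa using h1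
    simpa using h2 ⟨e, Algebra.subset_adjoin he⟩
  exfalso
  obtain ⟨P, hP⟩ := Ideal.nonempty_minimalPrimes htop
  have hPp : P.IsPrime := hP.1.1
  obtain ⟨k, B, _, _, _, α, ψ, φ, hαψ, hψ, hφ⟩ :=
    exists_reduced_of_mem_minimalPrimes (hD.isRadical_conductorIdeal T) hP
  have key := h k B α ψ φ hαψ
  let N : Subalgebra D K :=
    { carrier := {t | ∃ s, s ∉ P ∧ algebraMap D K s * t ∈ (algebraMap D K).range}
      mul_mem' := by
        rintro a b ⟨s, hs, x, hx⟩ ⟨s', hs', y, hy⟩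
        refine ⟨s * s', P.primeCompl.mul_mem hs hs', x * y, ?_⟩
        rw [map_mul, map_mul, hx, hy]; ring
      add_mem' := by
        rintro a b ⟨s, hs, x, hx⟩ ⟨s', hs', y, hy⟩
        refine ⟨s * s', P.primeCompl.mul_mem hs hs', s' * x + s * y, ?_⟩
        rw [map_mul, map_add, map_mul, map_mul, hx, hy]; ring
      algebraMap_mem' := fun r => ⟨1, P.primeCompl.one_mem, r, by simp⟩ }
  have hEN : E ⊆ N := by
    intro e he
    obtain ⟨z, hz⟩ := key e he
    obtain ⟨d, s, hsP, hds⟩ := hψ z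
    set t : T := ⟨e, Algebra.subset_adjoin he⟩
    -- A multiple of `s t - d` by some `s'` outside `P` is then in the conductor, in particular in
    -- `D`; so `s' s` is a denominator for `e`.
    have : φ (algebraMap D T s * t - algebraMap D T d) = 0 := by
      rw [map_sub, map_mul, ← hz, hds, sub_self]
    obtain ⟨s', hs', hm⟩ := hφ _ this
    obtain ⟨r, hr⟩ := hm 1
    refine ⟨s' * s, P.primeCompl.mul_mem hs' hsP, r + s' * d, ?_⟩
    rw [map_add, hr, map_mul, map_mul]
    push_cast
    change algebraMap D K s' * (algebraMap D K s * e - algebraMap D K d) * 1 + _ = _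
    ring
  have hTN : T ≤ N := Algebra.adjoin_le hEN
  -- Integrality makes `T` a finite `D`-module, so the denominators of its generators multiply to
  -- one element outside `P` that carries `T` into `D`. It lies in the conductor, hence in `P`: a
  -- contradiction.
  obtain ⟨F, hF⟩ := fg_adjoin_of_finite hE hint
  have hFN (f : K) (hf : f ∈ F) : f ∈ N :=
    hTN (show f ∈ Subalgebra.toSubmodule T from hF ▸ Submodule.subset_span hf)
  choose! σ hσ hσ' using hFN
  have hprod : ∏ f ∈ F, σ f ∉ P := P.primeCompl.prod_mem hσ
  refine hprod (hP.1.2 ?_)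
  intro t
  obtain ⟨t, ht⟩ := t
  have ht' : t ∈ Submodule.span D (F : Set K) := by rw [hF]; exact ht
  change algebraMap D K (∏ f ∈ F, σ f) * t ∈ _
  clear ht
  induction ht' using Submodule.span_induction with
  | mem x hx =>
    rw [← Finset.prod_erase_mul _ _ hx, map_mul, mul_assoc]
    exact mul_mem ⟨_, rfl⟩ (hσ' x hx)
  | zero => simp
  | add x y _ _ hx hy => rw [mul_add]; exact add_mem hx hy
  | smul a x _ hx => rw [Algebra.smul_def, mul_left_comm]; exact mul_mem ⟨_, rfl⟩ hx

/-! ### Integrality of the coefficients of a factor -/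

theorem exists_eq_C_mul_map_contentIdeal_eq_top {K : Type*} [Field K] (V : ValuationSubring K)
    {p : K[X]} (hp : p ≠ 0) :
    ∃ (c : K) (q : V[X]), c ≠ 0 ∧ q.contentIdeal = ⊤ ∧ p = C c * q.map (algebraMap V K) := by
  obtain ⟨i, hi, hmax⟩ := Finset.exists_max_image p.support (fun n => V.valuation (p.coeff n))
    (support_nonempty.2 hp)
  have hi0 : p.coeff i ≠ 0 := mem_support_iff.1 hi
  have hV (n : ℕ) : p.coeff n / p.coeff i ∈ V := by
    rw [← V.valuation_le_one_iff, map_div₀]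
    by_cases hn : p.coeff n = 0
    · simp [hn]
    · exact div_le_one_of_le₀ (hmax n (mem_support_iff.2 hn)) zero_le
  obtain ⟨q, hq⟩ := (mem_lifts (f := algebraMap V K) (C (p.coeff i)⁻¹ * p)).1 <|
    (lifts_iff_coeff_lifts _).2 fun n => ⟨⟨_, hV n⟩, by
      change p.coeff n / p.coeff i = _
      rw [coeff_C_mul, div_eq_inv_mul]⟩
  -- Dividing by a coefficient of maximal valuation leaves all coefficients in `V`, one of them
  -- equal to `1`.
  refine ⟨p.coeff i, q, hi0, ?_, ?_⟩
  · rw [Ideal.eq_top_iff_one]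
    convert! q.coeff_mem_contentIdeal i
    refine Subtype.val_injective ?_
    change (1 : K) = algebraMap V K _
    rw [← coeff_map, hq, coeff_C_mul, inv_mul_cancel₀ hi0]
  · rw [hq, ← mul_assoc, ← C_mul, mul_inv_cancel₀ hi0, C_1, one_mul]

theorem mem_of_forall_mul_coeff_mem {K : Type*} [Field K] (V : ValuationSubring K) {c : K}
    {q : V[X]} (hq : q.contentIdeal = ⊤) (h : ∀ n, c * (q.coeff n : K) ∈ V) : c ∈ V := by
  let J : Ideal V :=
    { carrier := {r | c * (r : K) ∈ V}
      add_mem' := fun {a b} ha hb => by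
        change c * ((a : K) + b) ∈ V
        rw [mul_add]; exact add_mem ha hb
      zero_mem' := by simp
      smul_mem' := fun r x hx => by
        change c * ((r : K) * x) ∈ V
        rw [mul_left_comm]; exact mul_mem r.2 hx }
  have hJ : q.contentIdeal ≤ J := by
    rw [contentIdeal_def, Ideal.span_le]
    intro r hr
    obtain ⟨n, -, rfl⟩ := mem_coeffs_iff.1 hr
    exact h n
  have : (1 : V) ∈ J := hJ (hq ▸ Submodule.mem_top)
  simpa [J] using this

/-- Gauss's lemma: for `p = c p'` and `q = d q'` with `p'`, `q'` of unit content, `p' q'` has unit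
content, so `c d ∈ V`. The constant coefficient `1` of `p` forces `c⁻¹ ∈ V`, hence `d ∈ V`. -/
theorem coeff_mem_valuationSubring_of_mul {K : Type*} [Field K] (V : ValuationSubring K)
    {p q : K[X]} (hp : p.coeff 0 = 1) (h : ∀ n, (p * q).coeff n ∈ V) (n : ℕ) :
    q.coeff n ∈ V := by
  by_cases hq0 : q = 0
  · simp [hq0]
  have hp0 : p ≠ 0 := by rintro rfl; simp at hp
  obtain ⟨c, p', hc, hp', rfl⟩ := exists_eq_C_mul_map_contentIdeal_eq_top V hp0
  obtain ⟨d, q', -, hq', rfl⟩ := exists_eq_C_mul_map_contentIdeal_eq_top V hq0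
  have hcd : c * d ∈ V := by
    refine mem_of_forall_mul_coeff_mem V (contentIdeal_mul_eq_top_of_contentIdeal_eq_top hp' hq')
      fun n => ?_
    convert! h n using 1
    rw [mul_mul_mul_comm, ← C_mul, ← Polynomial.map_mul, coeff_C_mul, coeff_map]
    rfl
  have hcinv : c⁻¹ ∈ V := by
    rw [coeff_C_mul, coeff_map] at hp
    rw [inv_eq_of_mul_eq_one_right hp]
    exact (p'.coeff 0).2
  have hd : d ∈ V := by
    have := mul_mem hcinv hcd
    rwa [inv_mul_cancel_left₀ hc] at this
  rw [coeff_C_mul, coeff_map]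
  exact mul_mem hd (q'.coeff n).2

/-- The integral closure of `D` in `K` is the intersection of the valuation rings containing the
image of `D`, and Gauss's lemma applies in each. -/
theorem isIntegral_coeff_of_mul {D K : Type*} [CommRing D] [Field K] [Algebra D K] {p q : K[X]}
    (hp : p.coeff 0 = 1) (h : p * q ∈ lifts (algebraMap D K)) (n : ℕ) :
    IsIntegral D (q.coeff n) := by
  have h1 : q.coeff n ∈ ⨅ V : {V : ValuationSubring K //
      ((algebraMap D K).range : Set K) ⊆ V.toSubring}, V.1.toSubring := by
    rw [Subring.mem_iInf]
    rintro ⟨V, hV⟩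
    refine coeff_mem_valuationSubring_of_mul V hp (fun n => hV ?_) n
    exact (lifts_iff_coeff_lifts _).1 h n
  rw [iInf_valuationSubring_superset] at h1
  have h2 : IsIntegral (Subring.closure ((algebraMap D K).range : Set K)) (q.coeff n) := h1
  obtain ⟨r, hr, hr0⟩ := h2
  have h3 : r.map (algebraMap _ K) ∈ lifts (algebraMap D K) := by
    refine (lifts_iff_coeff_lifts _).2 fun n => ?_
    rw [coeff_map]
    exact Subring.closure_le.2 (subset_rfl : _ ⊆ ((algebraMap D K).range : Set K)) (r.coeff n).2
  obtain ⟨s, hs, -, hsm⟩ := lifts_and_natDegree_eq_and_monic h3 (hr.map _)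
  refine ⟨s, hsm, ?_⟩
  rw [← eval_map, hs, eval_map, hr0]

/-! ### Seminormality of polynomial rings -/

/-- Descent of polynomials to a seminormal domain. -/
theorem IsSeminormal.mem_lifts_of_forall_reduced {D K : Type u} [CommRing D] [Field K]
    [Algebra D K] [FaithfulSMul D K] (hD : IsSeminormal D) {ι : Type*} [Finite ι] (f : ι → K[X])
    (hint : ∀ i n, IsIntegral D ((f i).coeff n))
    (h : ∀ (k B : Type u) [Field k] [CommRing B] [IsReduced B] (T : Subalgebra D K)
      (α : D →+* k) (ψ : k →+* B) (φ : T →+* B) (g : ι → T[X]),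
      φ.comp (algebraMap D T) = ψ.comp α → (∀ i, (g i).map (algebraMap T K) = f i) →
      ∀ i, (g i).map φ ∈ lifts ψ) (i : ι) :
    f i ∈ lifts (algebraMap D K) := by
  let E : Set K := ⋃ i, ((f i).coeffs : Set K)
  have hcoeff (i : ι) (n : ℕ) (h0 : (f i).coeff n ≠ 0) : (f i).coeff n ∈ E :=
    Set.mem_iUnion.2 ⟨i, coeff_mem_coeffs h0⟩
  have hE : E ⊆ (algebraMap D K).range := by
    refine hD.subset_range_of_forall_reduced (Set.finite_iUnion fun i => Finset.finite_toSet _)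
      ?_ ?_
    · intro e he
      obtain ⟨i, hi⟩ := Set.mem_iUnion.1 he
      obtain ⟨n, -, rfl⟩ := mem_coeffs_iff.1 hi
      exact hint i n
    · intro k B _ _ _ α ψ φ hφ e he
      have hl (i : ι) : ∃ g : (Algebra.adjoin D E)[X], g.map (algebraMap _ K) = f i := by
        refine (mem_lifts _).1 ((lifts_iff_coeff_lifts _).2 fun n => ?_)
        by_cases h0 : (f i).coeff n = 0
        · exact ⟨0, by simp [h0]⟩
        · exact ⟨⟨_, Algebra.subset_adjoin (hcoeff i n h0)⟩, rfl⟩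
      choose g hg using hl
      obtain ⟨i, hi⟩ := Set.mem_iUnion.1 he
      obtain ⟨n, -, rfl⟩ := mem_coeffs_iff.1 hi
      have := (lifts_iff_coeff_lifts _).1 (h k B _ α ψ φ g hφ hg i) n
      rw [coeff_map] at this
      convert! this
      rw [← hg i, coeff_map]
      rfl
  refine (lifts_iff_coeff_lifts _).2 fun n => ?_
  by_cases h0 : (f i).coeff n = 0
  · exact ⟨0, by simp [h0]⟩
  · exact hE (hcoeff i n h0)

theorem IsSeminormal.of_isIntegrallyClosed {R : Type*} [CommRing R] [IsDomain R]
    [IsIntegrallyClosed R] : IsSeminormal R := by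
  intro a b hab
  by_cases hb : b = 0
  · subst hb
    refine ⟨0, ?_, by simp⟩
    rw [zero_pow (by norm_num)] at hab ⊢
    exact (pow_eq_zero_iff two_ne_zero |>.1 hab).symm
  · obtain ⟨c, rfl⟩ : b ∣ a := by
      rw [← IsIntegrallyClosed.pow_dvd_pow_iff two_ne_zero, hab]
      exact pow_dvd_pow b (by norm_num)
    have hc : c ^ 2 = b := by
      refine mul_left_cancel₀ (pow_ne_zero 2 hb) ?_
      linear_combination hab
    exact ⟨c, by linear_combination c * hc, hc⟩

theorem eq_of_sq_eq_of_cube_eq {R : Type*} [CommRing R] [IsReduced R] {x y : R}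
    (h2 : x ^ 2 = y ^ 2) (h3 : x ^ 3 = y ^ 3) : x = y := by
  refine sub_eq_zero.1 (IsReduced.eq_zero _ ⟨3, ?_⟩)
  linear_combination 4 * h3 - 3 * (x + y) * h2

theorem isReduced_polynomial {R : Type*} [CommRing R] [IsReduced R] : IsReduced R[X] :=
  ⟨fun p hp => by
    ext n
    exact (Polynomial.isNilpotent_iff.1 hp n).eq_zero⟩

attribute [local instance] Polynomial.algebra in
theorem IsSeminormal.polynomial {D : Type u} [CommRing D] [IsDomain D] (hD : IsSeminormal D) :
    IsSeminormal D[X] := by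
  intro a b hab
  let K := FractionRing D
  have hinj : Function.Injective (mapRingHom (algebraMap D K)) :=
    map_injective _ (FaithfulSMul.algebraMap_injective D K)
  have : IsIntegrallyClosed K[X] := UniqueFactorizationMonoid.instIsIntegrallyClosed
  obtain ⟨c, hc3, hc2⟩ := IsSeminormal.of_isIntegrallyClosed (R := K[X])
    (mapRingHom (algebraMap D K) a) (mapRingHom (algebraMap D K) b) (by
      rw [← map_pow, hab, map_pow])
  have hint (n : ℕ) : IsIntegral D (c.coeff n) := by
    refine IsIntegral.coeff (IsIntegral.of_pow (n := 2) (by norm_num) ?_) n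
    rw [hc2]
    exact isIntegral_algebraMap (R := D[X])
  have hlift := hD.mem_lifts_of_forall_reduced (fun _ : Unit => c) (fun _ => hint) (by
    intro k B _ _ _ T α ψ φ g hφ hg _
    have hTinj : Function.Injective (mapRingHom (algebraMap T K)) :=
      map_injective _ (FaithfulSMul.algebraMap_injective T K)
    have key (m : ℕ) (x : D[X]) (hx : c ^ m = mapRingHom (algebraMap D K) x) :
        ((g ()).map φ) ^ m = mapRingHom ψ (mapRingHom α x) := by
      have : g () ^ m = mapRingHom (algebraMap D T) x := hTinj (by
        rw [map_pow, coe_mapRingHom, hg, hx, coe_mapRingHom, coe_mapRingHom, map_map,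
          ← IsScalarTower.algebraMap_eq])
      rw [← Polynomial.map_pow, this, coe_mapRingHom, coe_mapRingHom, coe_mapRingHom, map_map,
        map_map, hφ]
    -- The root found over `k` has in `B[X]` the same square and cube as the image of `c`, so the
    -- two agree there.
    have : IsIntegrallyClosed k[X] := UniqueFactorizationMonoid.instIsIntegrallyClosed
    obtain ⟨d, hd3, hd2⟩ := IsSeminormal.of_isIntegrallyClosed (R := k[X])
      (mapRingHom α a) (mapRingHom α b) (by rw [← map_pow, hab, map_pow])
    have := isReduced_polynomial (R := B)
    refine (mem_lifts _).2 ⟨d, eq_of_sq_eq_of_cube_eq ?_ ?_⟩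
    · rw [key 2 b hc2, ← hd2, map_pow, coe_mapRingHom]
    · rw [key 3 a hc3, ← hd3, map_pow, coe_mapRingHom]) ()
  obtain ⟨d, rfl⟩ := (mem_lifts _).1 hlift
  refine ⟨d, hinj ?_, hinj ?_⟩
  · rw [map_pow]; exact hc3
  · rw [map_pow]; exact hc2

/-! ### Idempotent matrices and the PRINC property of polynomial rings -/

/-- A matrix `!![a, b; c, d]` of trace one is the product of a column `f` and a row `g`. -/
structure IsRankOneFactorization {R : Type*} [CommRing R] (a b c d : R) (f g : Fin 2 → R) :
    Prop where
  h00 : f 0 * g 0 = a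
  h01 : f 0 * g 1 = b
  h10 : f 1 * g 0 = c
  h11 : f 1 * g 1 = d
  trace : f 0 * g 0 + f 1 * g 1 = 1

theorem IsRankOneFactorization.map {R R' : Type*} [CommRing R] [CommRing R'] (φ : R →+* R')
    {a b c d : R} {f g : Fin 2 → R} (h : IsRankOneFactorization a b c d f g) :
    IsRankOneFactorization (φ a) (φ b) (φ c) (φ d) (φ ∘ f) (φ ∘ g) := by
  obtain ⟨rfl, rfl, rfl, rfl, ht⟩ := h
  refine ⟨?_, ?_, ?_, ?_, ?_⟩ <;> simp only [Function.comp, ← map_mul, ← map_add]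
  rw [ht, map_one]

theorem IsRankOneFactorization.of_map {R R' : Type*} [CommRing R] [CommRing R'] {φ : R →+* R'}
    (hφ : Function.Injective φ) {a b c d : R} {f g : Fin 2 → R}
    (h : IsRankOneFactorization (φ a) (φ b) (φ c) (φ d) (φ ∘ f) (φ ∘ g)) :
    IsRankOneFactorization a b c d f g := by
  obtain ⟨h0, h1, h2, h3, ht⟩ := h
  simp only [Function.comp, ← map_mul, ← map_add] at h0 h1 h2 h3 ht
  exact ⟨hφ h0, hφ h1, hφ h2, hφ h3, hφ (by rw [ht, map_one])⟩

theorem IsRankOneFactorization.isPrincipal {R : Type*} [CommRing R] {a b c d : R}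
    {f g : Fin 2 → R} (h : IsRankOneFactorization a b c d f g) :
    (Ideal.span {a, b}).IsPrincipal := by
  obtain ⟨rfl, rfl, -, -, ht⟩ := h
  refine ⟨f 0, le_antisymm ?_ ?_⟩
  · rw [Ideal.span_le, Set.insert_subset_iff, Set.singleton_subset_iff]
    exact ⟨Ideal.mem_span_singleton.2 ⟨_, rfl⟩, Ideal.mem_span_singleton.2 ⟨_, rfl⟩⟩
  · refine (Ideal.span_singleton_le_iff_mem _).2 (Ideal.mem_span_pair.2 ⟨f 0, f 1, ?_⟩)
    linear_combination f 0 * ht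

theorem IsPRINC.exists_isRankOneFactorization {R : Type*} [CommRing R] [IsDomain R]
    (hR : IsPRINC R) {a b c : R} (h : a * (1 - a) = b * c) :
    ∃ f g, IsRankOneFactorization a b c (1 - a) f g := by
  -- A zero first row is treated apart, because the generator of `(a, b)` must be cancellable below.
  by_cases h0 : a = 0 ∧ b = 0
  · obtain ⟨rfl, rfl⟩ := h0
    exact ⟨![0, 1], ![c, 1], by constructor <;> simp⟩
  obtain ⟨d, hd⟩ := hR a b ((isIdempotentPair_iff a b).2 (Or.inl ⟨c, h⟩))
  have hd : Ideal.span {a, b} = Ideal.span {d} := hd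
  obtain ⟨g0, rfl⟩ := Ideal.mem_span_singleton.1
    (hd ▸ Ideal.subset_span (by simp) : a ∈ Ideal.span {d})
  obtain ⟨g1, rfl⟩ := Ideal.mem_span_singleton.1
    (hd ▸ Ideal.subset_span (by simp) : b ∈ Ideal.span {d})
  obtain ⟨x, y, hxy⟩ := Ideal.mem_span_pair.1
    (hd.symm ▸ Ideal.mem_span_singleton_self d : d ∈ Ideal.span {d * g0, d * g1})
  have hd0 : d ≠ 0 := by
    rintro rfl
    simp at h0
  have e1 : x * g0 + y * g1 = 1 := mul_left_cancel₀ hd0 (by linear_combination hxy)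
  have e2 : g0 * (1 - d * g0) = g1 * c := mul_left_cancel₀ hd0 (by linear_combination h)
  -- The column is the matrix applied to the Bézout vector `(x, y)`, whose pairing with the row is
  -- `1`.
  refine ⟨![d, x * c + y * (1 - d * g0)], ![g0, g1], rfl, rfl, ?_, ?_, ?_⟩
  · simp only [Matrix.cons_val_zero, Matrix.cons_val_one]
    linear_combination c * e1 + y * e2
  · simp only [Matrix.cons_val_zero, Matrix.cons_val_one]
    linear_combination (1 - d * g0) * e1 - x * e2
  · simp only [Matrix.cons_val_zero, Matrix.cons_val_one]
    linear_combination (1 - d * g0) * e1 - x * e2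

theorem isPRINC_of_forall_exists {R : Type*} [CommRing R]
    (h : ∀ a b c : R, a * (1 - a) = b * c → ∃ f g, IsRankOneFactorization a b c (1 - a) f g) :
    IsPRINC R := by
  intro a b hab
  obtain ⟨c, hc⟩ | ⟨c, hc⟩ := (isIdempotentPair_iff a b).1 hab
  · obtain ⟨f, g, hfg⟩ := h a b c hc
    exact hfg.isPrincipal
  · obtain ⟨f, g, hfg⟩ := h b a c hc
    rw [Set.pair_comm]
    exact hfg.isPrincipal

theorem IsPRINC.of_isPrincipalIdealRing {R : Type*} [CommRing R] [IsPrincipalIdealRing R] :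
    IsPRINC R := fun _ _ _ => IsPrincipalIdealRing.principal _

/-- Over a field, a factorization can be chosen with prescribed constant coefficients. -/
theorem exists_isRankOneFactorization_coeff_zero {k : Type*} [Field k] {a b c : k[X]}
    (h : a * (1 - a) = b * c) {p q : Fin 2 → k}
    (hpq : IsRankOneFactorization (a.coeff 0) (b.coeff 0) (c.coeff 0) ((1 - a).coeff 0) p q) :
    ∃ f g, IsRankOneFactorization a b c (1 - a) f g ∧ (∀ i, (f i).coeff 0 = p i) ∧
      ∀ i, (g i).coeff 0 = q i := by
  obtain ⟨f, g, hfg⟩ := IsPRINC.of_isPrincipalIdealRing.exists_isRankOneFactorization h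
  obtain ⟨h0, h1, h2, h3, ht⟩ := hfg.map (constantCoeff (R := k))
  obtain ⟨k0, k1, k2, k3, kt⟩ := hpq
  simp only [Function.comp, constantCoeff_apply] at h0 h1 h2 h3 ht
  -- The constant terms of `f`, `g` and the pair `p`, `q` factor the same matrix, so they differ by
  -- inverse scalars; rescaling by `v` and `u` matches them.
  let u := q 0 * (f 0).coeff 0 + q 1 * (f 1).coeff 0
  let v := p 0 * (g 0).coeff 0 + p 1 * (g 1).coeff 0
  have huv : u * v = 1 := by
    simp only [u, v]
    linear_combination p 0 * q 0 * (h0 - k0) + p 1 * q 0 * (h1 - k1) + p 0 * q 1 * (h2 - k2) +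
      p 1 * q 1 * (h3 - k3) + (p 0 * q 0 + p 1 * q 1 + 1) * kt
  obtain ⟨l0, l1, l2, l3, lt⟩ := hfg
  have hC : C u * C v = 1 := by rw [← C_mul, huv, C_1]
  refine ⟨fun i => C v * f i, fun i => C u * g i, ⟨?_, ?_, ?_, ?_, ?_⟩, fun i => ?_, fun i => ?_⟩
  · linear_combination l0 + f 0 * g 0 * hC
  · linear_combination l1 + f 0 * g 1 * hC
  · linear_combination l2 + f 1 * g 0 * hC
  · linear_combination l3 + f 1 * g 1 * hC
  · linear_combination lt + (f 0 * g 0 + f 1 * g 1) * hC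
  · rw [coeff_C_mul]
    fin_cases i <;> simp only [v, Fin.mk_one, Fin.zero_eta]
    · linear_combination p 0 * (h0 - k0) + p 1 * (h1 - k1) + p 0 * kt
    · linear_combination p 0 * (h2 - k2) + p 1 * (h3 - k3) + p 1 * kt
  · rw [coeff_C_mul]
    fin_cases i <;> simp only [u, Fin.mk_one, Fin.zero_eta]
    · linear_combination q 0 * (h0 - k0) + q 1 * (h2 - k2) + q 0 * kt
    · linear_combination q 0 * (h1 - k1) + q 1 * (h3 - k3) + q 1 * kt

theorem eq_one_of_mul_eq_one_of_coeff_zero {B : Type*} [CommRing B] [IsReduced B] {u v : B[X]}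
    (huv : u * v = 1) (h0 : u.coeff 0 = 1) : u = 1 := by
  have := (isUnit_iff_coeff_isUnit_isNilpotent.1 (IsUnit.of_mul_eq_one v huv)).2
  ext n
  by_cases hn : n = 0
  · simp [hn, h0]
  · rw [(this n hn).eq_zero, coeff_one, if_neg hn]

/-- Over a reduced ring, a factorization is determined by the constant coefficients of its
column. -/
theorem IsRankOneFactorization.unique {B : Type*} [CommRing B] [IsReduced B] {a b c d : B[X]}
    {f g f' g' : Fin 2 → B[X]} (h : IsRankOneFactorization a b c d f g)
    (h' : IsRankOneFactorization a b c d f' g') (hf : ∀ i, (f i).coeff 0 = (f' i).coeff 0) : f = f' ∧ g = g' := by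
  obtain ⟨h0, h1, h2, h3, ht⟩ := h
  obtain ⟨k0, k1, k2, k3, kt⟩ := h'
  have ht0 := congrArg (fun p => p.coeff 0) ht
  simp only [coeff_add, mul_coeff_zero, coeff_one_zero] at ht0
  have huv : (g 0 * f' 0 + g 1 * f' 1) * (g' 0 * f 0 + g' 1 * f 1) = 1 := by
    linear_combination f 0 * g 0 * (k0 - h0) + f 0 * g 1 * (k2 - h2) + f 1 * g 0 * (k1 - h1) +
      f 1 * g 1 * (k3 - h3) + (f 0 * g 0 + f 1 * g 1 + 1) * ht
  have hu : g 0 * f' 0 + g 1 * f' 1 = 1 := by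
    refine eq_one_of_mul_eq_one_of_coeff_zero huv ?_
    simp only [coeff_add, mul_coeff_zero, ← hf]
    linear_combination ht0
  have hv : g' 0 * f 0 + g' 1 * f 1 = 1 := by rwa [hu, one_mul] at huv
  constructor
  · funext i
    fin_cases i
    · change f 0 = f' 0
      linear_combination -f 0 * hu + f' 0 * (h0 - k0) + f' 1 * (h1 - k1) + f' 0 * kt
    · change f 1 = f' 1
      linear_combination -f 1 * hu + f' 0 * (h2 - k2) + f' 1 * (h3 - k3) + f' 1 * kt
  · funext i
    fin_cases i
    · change g 0 = g' 0
      linear_combination -g 0 * hv + g' 0 * (h0 - k0) + g' 1 * (h2 - k2) + g' 0 * kt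
    · change g 1 = g' 1
      linear_combination -g 1 * hv + g' 0 * (h1 - k1) + g' 1 * (h3 - k3) + g' 1 * kt

/-- A factorization is only determined up to a unit scalar. Prescribing constant coefficients taken
from a factorization over `D` removes this freedom, so the factorizations over `K` and over `k`
become comparable in `B[X]`. -/
theorem IsPRINC.polynomial {D : Type u} [CommRing D] [IsDomain D] (hD : IsSeminormal D)
    (hP : IsPRINC D) : IsPRINC D[X] := by
  refine isPRINC_of_forall_exists fun a b c habc => ?_
  let K := FractionRing D
  obtain ⟨p, q, hpq⟩ := hP.exists_isRankOneFactorization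
    (a := a.coeff 0) (b := b.coeff 0) (c := c.coeff 0) (by
      have := congrArg (fun p => p.coeff 0) habc
      simpa [mul_coeff_zero] using this)
  have hpq1 : IsRankOneFactorization (a.coeff 0) (b.coeff 0) (c.coeff 0) ((1 - a).coeff 0) p q := by
    simpa using hpq
  have exists_over {k : Type u} [Field k] (α : D →+* k) : ∃ f g : Fin 2 → k[X],
      IsRankOneFactorization (mapRingHom α a) (mapRingHom α b) (mapRingHom α c)
        (mapRingHom α (1 - a)) f g ∧ (∀ i, (f i).coeff 0 = α (p i)) ∧
        ∀ i, (g i).coeff 0 = α (q i) := by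
    have := exists_isRankOneFactorization_coeff_zero (k := k) (a := mapRingHom α a)
      (b := mapRingHom α b) (c := mapRingHom α c) (by
        rw [← map_mul, ← habc, map_mul, map_sub, map_one]) (p := α ∘ p) (q := α ∘ q) (by
        have := hpq1.map α
        rw [← map_one (mapRingHom α), ← map_sub]
        simpa only [coe_mapRingHom, coeff_map] using this)
    rwa [← map_one (mapRingHom α), ← map_sub] at this
  have hinj : Function.Injective (mapRingHom (algebraMap D K)) :=
    map_injective _ (FaithfulSMul.algebraMap_injective D K)
  obtain ⟨f, g, hfg, hf, hg⟩ := exists_over (algebraMap D K)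
  have hlift (x : D[X]) : mapRingHom (algebraMap D K) x ∈ lifts (algebraMap D K) :=
    (mem_lifts _).2 ⟨x, rfl⟩
  have hClift (x : D) : C (algebraMap D K x) ∈ lifts (algebraMap D K) :=
    (mem_lifts _).2 ⟨C x, by simp⟩
  have hK := hpq.map (algebraMap D K)
  -- Multiplying the matrix on the left by the row `q` gives `(q · f) g` with coefficients in `D`,
  -- and `q · f` has constant coefficient `q · p = 1`.
  have hintg (i : Fin 2) (n : ℕ) : IsIntegral D ((g i).coeff n) := by
    refine isIntegral_coeff_of_mul
      (p := C (algebraMap D K (q 0)) * f 0 + C (algebraMap D K (q 1)) * f 1) ?_ ?_ n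
    · rw [coeff_add, coeff_C_mul, coeff_C_mul, hf, hf]
      have := hK.trace
      simp only [Function.comp] at this
      linear_combination this
    · rw [add_mul, mul_assoc, mul_assoc]
      fin_cases i
      · refine add_mem (mul_mem (hClift _) ?_) (mul_mem (hClift _) ?_)
        · exact hfg.h00 ▸ hlift a
        · exact hfg.h10 ▸ hlift c
      · refine add_mem (mul_mem (hClift _) ?_) (mul_mem (hClift _) ?_)
        · exact hfg.h01 ▸ hlift b
        · exact hfg.h11 ▸ hlift (1 - a)
  have hintf (i : Fin 2) (n : ℕ) : IsIntegral D ((f i).coeff n) := by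
    refine isIntegral_coeff_of_mul
      (p := C (algebraMap D K (p 0)) * g 0 + C (algebraMap D K (p 1)) * g 1) ?_ ?_ n
    · rw [coeff_add, coeff_C_mul, coeff_C_mul, hg, hg]
      have := hK.trace
      simp only [Function.comp] at this
      linear_combination this
    · rw [add_mul, mul_assoc, mul_assoc, mul_comm (g 0), mul_comm (g 1)]
      fin_cases i
      · refine add_mem (mul_mem (hClift _) ?_) (mul_mem (hClift _) ?_)
        · exact hfg.h00 ▸ hlift a
        · exact hfg.h01 ▸ hlift b
      · refine add_mem (mul_mem (hClift _) ?_) (mul_mem (hClift _) ?_)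
        · exact hfg.h10 ▸ hlift c
        · exact hfg.h11 ▸ hlift (1 - a)
  have key := hD.mem_lifts_of_forall_reduced (Sum.elim f g)
    (by rintro (i | i) n; exacts [hintf i n, hintg i n]) (by
    intro k B _ _ _ T α ψ φ F hφ hF
    have hTinj : Function.Injective (mapRingHom (algebraMap T K)) :=
      map_injective _ (FaithfulSMul.algebraMap_injective T K)
    have hDT (x : D[X]) : mapRingHom (algebraMap T K) (mapRingHom (algebraMap D T) x) =
        mapRingHom (algebraMap D K) x := by
      simp only [coe_mapRingHom]
      rw [map_map, ← IsScalarTower.algebraMap_eq]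
    have hDB (x : D[X]) : mapRingHom φ (mapRingHom (algebraMap D T) x) =
        mapRingHom ψ (mapRingHom α x) := by
      simp only [coe_mapRingHom]
      rw [map_map, map_map, hφ]
    have hTfac : IsRankOneFactorization (mapRingHom (algebraMap D T) a)
        (mapRingHom (algebraMap D T) b) (mapRingHom (algebraMap D T) c)
        (mapRingHom (algebraMap D T) (1 - a)) (F ∘ Sum.inl) (F ∘ Sum.inr) := by
      refine IsRankOneFactorization.of_map hTinj ?_
      simp only [hDT]
      have e1 : mapRingHom (algebraMap T K) ∘ F ∘ Sum.inl = f := funext fun i => hF (Sum.inl i)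
      have e2 : mapRingHom (algebraMap T K) ∘ F ∘ Sum.inr = g := funext fun i => hF (Sum.inr i)
      rw [e1, e2]
      exact hfg
    have hB1 := hTfac.map (mapRingHom φ)
    obtain ⟨f', g', hfg', hf', -⟩ := exists_over α
    have hB2 := hfg'.map (mapRingHom ψ)
    simp only [hDB] at hB1
    have hcoeff (j : Fin 2 ⊕ Fin 2) (x : D) (hx : (Sum.elim f g j).coeff 0 = algebraMap D K x) :
        ((F j).map φ).coeff 0 = ψ (α x) := by
      have : (F j).coeff 0 = algebraMap D T x := FaithfulSMul.algebraMap_injective T K (by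
        rw [← coeff_map, hF, hx, ← IsScalarTower.algebraMap_apply])
      rw [coeff_map, this]
      exact congrArg (fun r : D →+* B => r x) hφ
    obtain ⟨e1, e2⟩ := hB1.unique hB2
      (fun i => by
        simp only [Function.comp, coe_mapRingHom]
        rw [hcoeff (Sum.inl i) (p i) (hf i), coeff_map, hf'])
    rintro (i | i)
    · exact (mem_lifts _).2 ⟨f' i, (congrFun e1 i).symm⟩
    · exact (mem_lifts _).2 ⟨g' i, (congrFun e2 i).symm⟩)
  choose F hF using fun j => (mem_lifts _).1 (key j)
  refine ⟨F ∘ Sum.inl, F ∘ Sum.inr, IsRankOneFactorization.of_map hinj ?_⟩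
  have e1 : mapRingHom (algebraMap D K) ∘ F ∘ Sum.inl = f := funext fun i => hF (Sum.inl i)
  have e2 : mapRingHom (algebraMap D K) ∘ F ∘ Sum.inr = g := funext fun i => hF (Sum.inr i)
  rw [e1, e2]
  exact hfg

/-! ### Pure monoids: the monoid domain as a directed union of polynomial rings -/

section Monoid

variable {S : Type*} [AddCommMonoid S]

theorem IsPureMonoid.nsmul_left_injective (hS : IsPureMonoid S) {s : S} (hs : s ≠ 0) :
    Function.Injective fun n : ℕ => n • s := by
  obtain ⟨T, ⟨e⟩⟩ := hS.embeds
  have h0 : ((e s : T) : NNRat) ≠ 0 := by simpa using hs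
  intro n m hnm
  have : n • ((e s : T) : NNRat) = m • ((e s : T) : NNRat) := by
    rw [← AddSubmonoidClass.coe_nsmul, ← AddSubmonoidClass.coe_nsmul, ← map_nsmul, ← map_nsmul]
    exact congrArg (fun x => ((e x : T) : NNRat)) hnm
  rw [nsmul_eq_mul, nsmul_eq_mul] at this
  exact_mod_cast mul_right_cancel₀ h0 this

theorem IsLocallyCyclic.exists_mem_multiples (hS : IsLocallyCyclic S) (s₁ s₂ : S) :
    ∃ s, s₁ ∈ AddSubmonoid.multiples s ∧ s₂ ∈ AddSubmonoid.multiples s := by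
  obtain ⟨s, hs⟩ := hS s₁ s₂
  exact ⟨s, hs (AddSubmonoid.mem_sup_left (AddSubmonoid.mem_multiples s₁)),
    hs (AddSubmonoid.mem_sup_right (AddSubmonoid.mem_multiples s₂))⟩

end Monoid

section MonoidAlgebra

variable {D : Type*} [CommRing D] {S : Type*} [AddCommMonoid S]

theorem coeff_aeval_single {s : S} (hs : Function.Injective fun n : ℕ => n • s) (p : D[X])
    (n : ℕ) : (aeval (AddMonoidAlgebra.single s (1 : D)) p).coeff (n • s) = p.coeff n := by
  induction p using Polynomial.induction_on' with
  | add p q hp hq => rw [map_add, AddMonoidAlgebra.coeff_add, Finsupp.add_apply, hp, hq, coeff_add]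
  | monomial m a =>
    classical
    rw [aeval_monomial, AddMonoidAlgebra.single_pow, one_pow, AddMonoidAlgebra.coe_algebraMap,
      Function.comp_apply, Algebra.algebraMap_self, RingHom.id_apply,
      AddMonoidAlgebra.single_mul_single, zero_add, mul_one, AddMonoidAlgebra.coeff_single,
      Finsupp.single_apply, coeff_monomial]
    exact if_congr hs.eq_iff rfl rfl

theorem aeval_single_injective {s : S} (hs : Function.Injective fun n : ℕ => n • s) :
    Function.Injective (aeval (R := D) (AddMonoidAlgebra.single s (1 : D))) := by
  intro p q hpq
  ext n
  rw [← coeff_aeval_single hs, hpq, coeff_aeval_single hs]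

theorem range_aeval_single_mono {s t : S} (h : t ∈ AddSubmonoid.multiples s) :
    (aeval (R := D) (AddMonoidAlgebra.single t (1 : D))).range ≤
      (aeval (R := D) (AddMonoidAlgebra.single s (1 : D))).range := by
  obtain ⟨n, rfl⟩ := h
  rintro _ ⟨p, rfl⟩
  refine ⟨expand D n p, ?_⟩
  change aeval _ (expand D n p) = aeval _ p
  rw [expand_aeval, AddMonoidAlgebra.single_pow, one_pow]

theorem IsLocallyCyclic.exists_mem_range_aeval (hS : IsLocallyCyclic S)
    (x : AddMonoidAlgebra D S) :
    ∃ s, x ∈ (aeval (R := D) (AddMonoidAlgebra.single s (1 : D))).range := by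
  induction x using AddMonoidAlgebra.induction_linear with
  | zero => exact ⟨0, zero_mem _⟩
  | add x y hx hy =>
    obtain ⟨s₁, h₁⟩ := hx
    obtain ⟨s₂, h₂⟩ := hy
    obtain ⟨s, hs₁, hs₂⟩ := hS.exists_mem_multiples s₁ s₂
    exact ⟨s, add_mem (range_aeval_single_mono hs₁ h₁) (range_aeval_single_mono hs₂ h₂)⟩
  | single s a =>
    refine ⟨s, monomial 1 a, ?_⟩
    change aeval _ (monomial 1 a) = _
    rw [aeval_monomial, pow_one, AddMonoidAlgebra.coe_algebraMap,
      Function.comp_apply, Algebra.algebraMap_self, RingHom.id_apply,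
      AddMonoidAlgebra.single_mul_single, zero_add, mul_one]

/-- Finitely many elements of the monoid algebra lie in one polynomial subring. -/
theorem IsPureMonoid.exists_aeval_single [Nontrivial S] (hS : IsPureMonoid S)
    {ι : Type*} [Finite ι] (x : ι → AddMonoidAlgebra D S) :
    ∃ φ : D[X] →ₐ[D] AddMonoidAlgebra D S, Function.Injective φ ∧ ∃ p : ι → D[X], φ ∘ p = x := by
  suffices H : ∃ s : S, s ≠ 0 ∧
      ∀ i, x i ∈ (aeval (R := D) (AddMonoidAlgebra.single s (1 : D))).range by
    obtain ⟨s, hs, h⟩ := H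
    choose p hp using h
    exact ⟨_, aeval_single_injective (hS.nsmul_left_injective hs), p, funext hp⟩
  choose σ hσ using fun i => hS.locallyCyclic.exists_mem_range_aeval (x i)
  obtain ⟨s₀, hs₀⟩ := exists_ne (0 : S)
  have key (F : Set S) (hF : F.Finite) : ∃ s : S, s ≠ 0 ∧ F ⊆ AddSubmonoid.multiples s := by
    induction F, hF using Set.Finite.induction_on with
    | empty => exact ⟨s₀, hs₀, Set.empty_subset _⟩
    | insert _ _ ih =>
      rename_i a _ _ _
      obtain ⟨s, hs, h⟩ := ih
      obtain ⟨t, ht₁, ht₂⟩ := hS.locallyCyclic.exists_mem_multiples a s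
      refine ⟨t, ?_, Set.insert_subset ht₁ (h.trans ?_)⟩
      · rintro rfl
        obtain ⟨n, hn⟩ := ht₂
        exact hs (by rw [← hn]; exact smul_zero n)
      · exact (AddSubmonoid.multiples_le).2 ht₂
  obtain ⟨s, hs, h⟩ := key (Set.range σ) (Set.finite_range σ)
  exact ⟨s, hs, fun i => range_aeval_single_mono (h ⟨i, rfl⟩) (hσ i)⟩

variable [Nontrivial S]

theorem IsPureMonoid.isDomain [IsDomain D] (hS : IsPureMonoid S) :
    IsDomain (AddMonoidAlgebra D S) := by
  have : NoZeroDivisors (AddMonoidAlgebra D S) := ⟨by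
    intro a b hab
    obtain ⟨φ, hφ, p, hp⟩ := hS.exists_aeval_single ![a, b]
    obtain rfl : φ (p 0) = a := congrFun hp 0
    obtain rfl : φ (p 1) = b := congrFun hp 1
    rw [← map_mul, map_eq_zero_iff φ hφ, mul_eq_zero] at hab
    rwa [map_eq_zero_iff φ hφ, map_eq_zero_iff φ hφ]⟩
  exact NoZeroDivisors.to_isDomain _

theorem IsSeminormal.addMonoidAlgebra (hS : IsPureMonoid S) (hD : IsSeminormal D[X]) :
    IsSeminormal (AddMonoidAlgebra D S) := by
  intro a b hab
  obtain ⟨φ, hφ, p, hp⟩ := hS.exists_aeval_single ![a, b]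
  obtain rfl : φ (p 0) = a := congrFun hp 0
  obtain rfl : φ (p 1) = b := congrFun hp 1
  obtain ⟨c, h3, h2⟩ := hD (p 0) (p 1) (hφ (by rw [map_pow, map_pow, hab]))
  exact ⟨φ c, by rw [← map_pow, h3], by rw [← map_pow, h2]⟩

theorem IsPRINC.addMonoidAlgebra [IsDomain D] (hS : IsPureMonoid S) (hD : IsPRINC D[X]) :
    IsPRINC (AddMonoidAlgebra D S) := by
  refine isPRINC_of_forall_exists fun a b c h => ?_
  obtain ⟨φ, hφ, p, hp⟩ := hS.exists_aeval_single ![a, b, c]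
  obtain rfl : φ (p 0) = a := congrFun hp 0
  obtain rfl : φ (p 1) = b := congrFun hp 1
  obtain rfl : φ (p 2) = c := congrFun hp 2
  obtain ⟨f, g, hfg⟩ := hD.exists_isRankOneFactorization (a := p 0) (b := p 1) (c := p 2)
    (hφ (by rw [map_mul, map_mul, map_sub, map_one, h]))
  refine ⟨φ ∘ f, φ ∘ g, ?_⟩
  rw [← map_one φ, ← map_sub]
  exact hfg.map φ.toRingHom

theorem IsPureMonoid.coeff_eq_zero_of_isUnit [IsDomain D] (hS : IsPureMonoid S)
    {u : AddMonoidAlgebra D S} (hu : IsUnit u) {s : S} (hs : s ≠ 0) : u.coeff s = 0 := by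
  obtain ⟨v, huv⟩ := hu.exists_right_inv
  obtain ⟨φ, hφ, p, hp⟩ := hS.exists_aeval_single ![u, v]
  obtain rfl : φ (p 0) = u := congrFun hp 0
  obtain rfl : φ (p 1) = v := congrFun hp 1
  have : IsUnit (p 0) := IsUnit.of_mul_eq_one (p 1) (hφ (by rw [map_mul, huv, map_one]))
  obtain ⟨d, -, hd⟩ := Polynomial.isUnit_iff.1 this
  classical
  rw [← hd, ← Polynomial.algebraMap_eq, AlgHom.commutes, AddMonoidAlgebra.coe_algebraMap,
    Function.comp_apply, AddMonoidAlgebra.coeff_single, Finsupp.single_apply, if_neg hs.symm]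

/-! ### Comaximal factorizations of `1 - X ^ s` -/

/-- If every element of `S` is divisible by some integer `n > 1` that is invertible in `D`, then
`1 - X ^ s` has comaximal factorizations of any length. -/
theorem IsPureMonoid.exists_isComaximalFactorization [IsDomain D] (hS : IsPureMonoid S)
    (h : ∀ s : S, ∃ n : ℕ, 1 < n ∧ IsUnit (n : D) ∧ ∃ t : S, n • t = s) (m : ℕ) (hm : 1 ≤ m) :
    ∀ s : S, s ≠ 0 → ∃ c : Fin m → AddMonoidAlgebra D S,
      IsComaximalFactorization (1 - AddMonoidAlgebra.single s (1 : D)) c := by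
  have hnonunit (s : S) (hs : s ≠ 0) (p : D[X]) (hp : p.coeff 1 ≠ 0) :
      ¬ IsUnit (aeval (AddMonoidAlgebra.single s (1 : D)) p) := by
    intro hu
    have := hS.coeff_eq_zero_of_isUnit hu hs
    rw [← coeff_aeval_single (hS.nsmul_left_injective hs), one_smul] at hp
    exact hp this
  induction m, hm using Nat.le_induction with
  | base =>
    intro s hs
    refine ⟨fun _ => 1 - AddMonoidAlgebra.single s 1, by simp, fun _ => ?_,
      fun i j hij => absurd (Subsingleton.elim i j) hij⟩
    have := hnonunit s hs (1 - X) (by simp [coeff_one])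
    simpa using this
  | succ m hm ih =>
    intro s hs
    obtain ⟨n, hn, hu, t, rfl⟩ := h s
    have ht : t ≠ 0 := by
      rintro rfl
      exact hs (smul_zero n)
    obtain ⟨c, hc, hcu, hcc⟩ := ih t ht
    -- The induction hypothesis factors `1 - Y` into `m` parts; the geometric sum `g` is the
    -- additional one.
    set Y : AddMonoidAlgebra D S := AddMonoidAlgebra.single t 1 with hY
    have hYn : AddMonoidAlgebra.single (n • t) (1 : D) = Y ^ n := by
      rw [hY, AddMonoidAlgebra.single_pow, one_pow]
    let g : AddMonoidAlgebra D S := ∑ i ∈ Finset.range n, Y ^ i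
    have hg : ¬ IsUnit g := by
      have := hnonunit t ht (∑ i ∈ Finset.range n, X ^ i) (by
        simp [finsetSum_coeff, coeff_X_pow, hn])
      rw [map_sum] at this
      simpa only [map_pow, aeval_X] using this
    have hcop : IsCoprime g (1 - Y) := by
      have hdvd : 1 - Y ∣ (n : AddMonoidAlgebra D S) - g := by
        have : (n : AddMonoidAlgebra D S) - g = ∑ i ∈ Finset.range n, (1 - Y ^ i) := by
          simp [g, Finset.sum_sub_distrib]
        rw [this]
        exact Finset.dvd_sum fun i _ => one_sub_dvd_one_sub_pow Y i
      obtain ⟨z, hz⟩ := hdvd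
      have hu' : IsUnit (n : AddMonoidAlgebra D S) := by
        simpa using hu.map (algebraMap D (AddMonoidAlgebra D S))
      obtain ⟨w, hw⟩ := hu'.exists_left_inv
      exact ⟨w, w * z, by linear_combination hw - w * hz⟩
    have hci (i : Fin m) : IsCoprime g (c i) :=
      hcop.of_isCoprime_of_dvd_right (hc ▸ Finset.dvd_prod_of_mem c (Finset.mem_univ i))
    refine ⟨Fin.cons g c, ?_, ?_, ?_⟩
    · rw [Fin.prod_cons, ← hc, hYn, mul_comm, mul_neg_geom_sum]
    · intro i
      refine Fin.cases ?_ (fun i => ?_) i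
      · exact hg
      · exact hcu i
    · intro i j
      refine Fin.cases ?_ (fun i => ?_) i <;> refine Fin.cases ?_ (fun j => ?_) j
      · exact fun h => absurd rfl h
      · exact fun _ => hci j
      · exact fun _ => (hci i).symm
      · exact fun h => hcc i j fun h' => h (by rw [h'])

end MonoidAlgebra

/-! ### Lengths of comaximal factorizations in PRINC domains -/

section Comaximal

variable {R : Type*} [CommRing R] [IsDomain R]

/-- In a PRINC domain, a pseudo-irreducible divisor of a product of two comaximal elements is
comaximal to one of them. -/
theorem IsPseudoIrreducible.isCoprime_or_isCoprime (hR : IsPRINC R) {c d₁ d₂ : R}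
    (hc : IsPseudoIrreducible c) (hd : IsCoprime d₁ d₂) (h : c ∣ d₁ * d₂) :
    IsCoprime c d₁ ∨ IsCoprime c d₂ := by
  obtain ⟨x, y, hxy⟩ := hd
  obtain ⟨r, hr⟩ := h
  -- The idempotent matrix with first row `(x d₁, c)` splits `c` as `f 0 * g 1`, comaximal by the
  -- trace identity; pseudo-irreducibility makes one factor a unit.
  obtain ⟨f, g, h0, h1, -, h3, ht⟩ := hR.exists_isRankOneFactorization
    (a := x * d₁) (b := c) (c := x * y * r) (by
      linear_combination x * y * hr - x * d₁ * hxy)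
  by_cases hf : IsUnit (f 0)
  · left
    rw [← h1, isCoprime_mul_unit_left_left hf]
    exact ⟨f 1, x, by linear_combination ht - h0⟩
  · by_cases hg : IsUnit (g 1)
    · right
      rw [← h1, isCoprime_mul_unit_right_left hg]
      exact ⟨g 0, y, by linear_combination ht - h3 + hxy⟩
    · exact absurd h1.symm (hc.2.2 (f 0) (g 1) ⟨g 0, f 1, by linear_combination ht⟩ hf hg)

/-- In a PRINC domain, a complete comaximal factorization has maximal length among comaximal
factorizations. -/
theorem IsCompleteComaximalFactorization.le (hR : IsPRINC R) {b : R} {m n : ℕ}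
    {c : Fin m → R} {d : Fin n → R} (hc : IsCompleteComaximalFactorization b c)
    (hd : IsComaximalFactorization b d) : n ≤ m := by
  by_contra! hmn
  obtain ⟨hc, hci, -⟩ := hc
  obtain ⟨hd, hdu, hdd⟩ := hd
  -- Each `c i` fails to be comaximal to at most one `d j`, while each `d j` meets some `c i` in
  -- this way; this gives an injection of indices.
  have key (i : Fin m) (j j' : Fin n) (hj : ¬ IsCoprime (c i) (d j))
      (hj' : ¬ IsCoprime (c i) (d j')) : j = j' := by
    by_contra hne
    have hcop : IsCoprime (d j) (∏ l ∈ Finset.univ.erase j, d l) :=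
      IsCoprime.prod_right fun l hl => hdd j l (Finset.ne_of_mem_erase hl).symm
    obtain h | h := (hci i).isCoprime_or_isCoprime hR hcop (by
      rw [Finset.mul_prod_erase _ _ (Finset.mem_univ j), ← hd, hc]
      exact Finset.dvd_prod_of_mem c (Finset.mem_univ i))
    · exact hj h
    · exact hj' (h.of_isCoprime_of_dvd_right (Finset.dvd_prod_of_mem d
        (Finset.mem_erase.2 ⟨Ne.symm hne, Finset.mem_univ j'⟩)))
  have hex (j : Fin n) : ∃ i, ¬ IsCoprime (c i) (d j) := by
    by_contra! H
    have h1 : IsCoprime (∏ i, c i) (d j) := IsCoprime.prod_left fun i _ => H i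
    rw [← hc, hd] at h1
    exact hdu j (h1.symm.isUnit_of_dvd (Finset.dvd_prod_of_mem d (Finset.mem_univ j)))
  choose σ hσ using hex
  have hinj : Function.Injective σ := fun j j' hjj =>
    key (σ j) j j' (hσ j) (hjj ▸ hσ j')
  exact absurd (by simpa using Fintype.card_le_of_injective σ hinj) hmn.not_ge

theorem not_hasComaximalFactorizations (hR : IsPRINC R) {b : R} (hb0 : b ≠ 0) (hb : ¬ IsUnit b)
    (h : ∀ m : ℕ, 1 ≤ m → ∃ d : Fin m → R, IsComaximalFactorization b d) :
    ¬ HasComaximalFactorizations R := by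
  intro H
  obtain ⟨m, c, hc⟩ := H b hb0 hb
  obtain ⟨d, hd⟩ := h (m + 1) (by lia)
  exact absurd (hc.le hR hd) (by lia)

end Comaximal

/-! ### Invertible divisors and conclusion -/

theorem exists_nsmul_eq_of_isPPure {D : Type*} [CommRing D] {S : Type*} [AddCommMonoid S] {p : ℕ}
    [CharP D p] (hp : p.Prime) (hS : IsPPure S p) (s : S) :
    ∃ n : ℕ, 1 < n ∧ IsUnit (n : D) ∧ ∃ t : S, n • t = s := by
  obtain ⟨n, hn, hnp, t, rfl⟩ := hS s
  -- The part `m` of `n` prime to `p` is invertible in characteristic `p`, and it is not `1` because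
  -- `n` is not a power of `p`.
  obtain ⟨k, m, hm, rfl⟩ := Nat.exists_eq_pow_mul_and_not_dvd (n := n) (by lia) p hp.ne_one
  refine ⟨m, ?_, ?_, p ^ k • t, by rw [smul_smul, mul_comm]⟩
  · refine (Nat.two_le_iff m).2 ⟨?_, ?_⟩
    · rintro rfl
      simp at hm
    · rintro rfl
      exact hnp k (mul_one _)
  · have hcop : IsCoprime (m : ℤ) (p : ℤ) :=
      Nat.isCoprime_iff_coprime.2 ((hp.coprime_iff_not_dvd.2 hm).symm)
    have := hcop.map (Int.castRingHom D)
    simpa [isCoprime_zero_right] using this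

end ComaximalFact

open ComaximalFact in
theorem mainTheorem7 {D : Type*} [CommRing D] [IsDomain D] (χ : ℕ) [CharP D χ]
    (hD_seminormal : IsSeminormal D) (hD_princ : IsPRINC D)
    {S : Type*} [AddCommMonoid S] [Nontrivial S] (hS : IsPureMonoid S)
    (h₁ : χ = 0 → (∃ p : ℕ, p.Prime ∧ IsPDivisible S p) →
      ∃ p : ℕ, p.Prime ∧ IsPDivisible S p ∧
        ∃ f : Localization.Away (p : ℤ) →+* D, Function.Injective f)
    (h₂ : χ = 0 → (∀ p : ℕ, p.Prime → ¬ IsPDivisible S p) →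
      ∃ f : ℚ →+* D, Function.Injective f)
    (h₃ : χ ≠ 0 → IsPPure S χ) :
    IsDomain (AddMonoidAlgebra D S) ∧
    IsSeminormal (AddMonoidAlgebra D S) ∧
    IsPRINC (AddMonoidAlgebra D S) ∧
    ¬ HasComaximalFactorizations (AddMonoidAlgebra D S) ∧
    ∀ s : S, s ≠ 0 → ∀ m : ℕ, 1 ≤ m → ∃ c : Fin m → AddMonoidAlgebra D S,
      IsComaximalFactorization (1 - AddMonoidAlgebra.single s (1 : D)) c := by
  have hdom := hS.isDomain (D := D)
  have hprinc := IsPRINC.addMonoidAlgebra hS (hD_princ.polynomial hD_seminormal)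
  have hdiv (s : S) : ∃ n : ℕ, 1 < n ∧ IsUnit (n : D) ∧ ∃ t : S, n • t = s := by
    by_cases hχ : χ = 0
    · by_cases hp : ∃ p : ℕ, p.Prime ∧ IsPDivisible S p
      · obtain ⟨p, hp, hpS, f, -⟩ := h₁ hχ hp
        refine ⟨p, hp.one_lt, ?_, hpS s⟩
        simpa using (IsLocalization.Away.algebraMap_isUnit (S := Localization.Away (p : ℤ))
          (p : ℤ)).map f
      · push Not at hp
        obtain ⟨f, -⟩ := h₂ hχ hp
        obtain ⟨n, hn, t, ht⟩ := hS.divisible s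
        refine ⟨n, hn, ?_, t, ht⟩
        have : IsUnit (n : ℚ) := by
          rw [isUnit_iff_ne_zero]
          exact_mod_cast (by lia : n ≠ 0)
        simpa using this.map f
    · exact exists_nsmul_eq_of_isPPure ((CharP.char_is_prime_or_zero D χ).resolve_right hχ)
        (h₃ hχ) s
  have hfac (s : S) (hs : s ≠ 0) (m : ℕ) (hm : 1 ≤ m) :=
    hS.exists_isComaximalFactorization hdiv m hm s hs
  refine ⟨hdom, hD_seminormal.polynomial.addMonoidAlgebra hS, hprinc, ?_, hfac⟩
  obtain ⟨s, hs⟩ := exists_ne (0 : S)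
  have hnot : ¬ IsUnit (1 - AddMonoidAlgebra.single s (1 : D)) := by
    obtain ⟨c, hc, hcu, -⟩ := hfac s hs 1 le_rfl
    rw [hc, Fin.prod_univ_one]
    exact hcu 0
  refine not_hasComaximalFactorizations hprinc (sub_ne_zero.2 fun h => hs ?_) hnot (hfac s hs)
  exact (AddMonoidAlgebra.single_left_injective (one_ne_zero (α := D)) h).symm
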